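/- Let $n\ge 2$ and let $\mathbb P^n=\{z\in\mathbb C^n: |z_i|<1,\ i=1,\dots,n\}$ be the unit polydisk. For a locally biholomorphic map $f=(f_1,\dots,f_n):\mathbb P^n\to\mathbb C^n$ with complex Jacobian $J_f=\det Df$, put $$S^k_{ij}f=\sum_{l=1}^n\frac{\partial^2 f_l}{\partial z_i\partial z_j}\frac{\partial z_k}{\partial f_l}-\frac1{n+1}\left(\delta^k_i\frac{\partial}{\partial z_j}+\delta^k_j\frac{\partial}{\partial z_i}\right)\log J_f ,\qquad 1\le i,j,k\le n,$$ where $\left(\partial z_k/\partial f_l\right)=(Df)^{-1}$, and let $S_f(z)(v)\in\mathbb C^n$ be the vector with $k$-th component $\sum_{i,j}S^k_{ij}f(z)v_iv_j$. Let $$\|v\|_z=\Big(2\sum_{i=1}^n\frac{|v_i|^2}{(1-|z_i|^2)^2}\Big)^{1/2}$$ be the Bergman norm at $z\in\mathbb P^n$, and let $\|S_f\|=\sup_{z\in\mathbb P^n}\sup_{\|v\|_z=1}\|S_f(z)(v)\|_z$. For $\alpha\ge 0$ let $\mathcal F_\alpha$ be the family of locally biholomorphic maps $f:\mathbb P^n\to\mathbb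 C^n$ with $f(0)=0$, $Df(0)=I$ and $\|S_f\|\le\alpha$, and let $$\lambda_\alpha=\sup_{f\in\mathcal F_\alpha}|\nabla J_f(0)|,$$ where $\nabla J_f=(\partial J_f/\partial z_1,\dots,\partial J_f/\partial z_n)$ and $|\cdot|$ is the Euclidean norm. Then for each $\sigma>0$ there is a constant $m(\sigma,n)>0$, depending only on $\sigma$ and $n$, such that for every $\alpha\ge 0$ the order $\lambda_\alpha$ is finite and $$\lambda_\alpha\le 2(n+1)+m(\sigma,n)\,\alpha^{1+\sigma}.$$ -/

import Mathlib

open scoped ENNReal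

noncomputable section

namespace PolydiskSchwarzian

/-- The unit polydisk `{z : |z_i| < 1 for all i}` of `ℂⁿ`. -/
def polydisk (n : ℕ) : Set (Fin n → ℂ) := {z | ∀ i, ‖z i‖ < 1}

/-- `f` is locally biholomorphic on `Ω`: every point of `Ω` has an open neighbourhood
contained in `Ω` on which `f` restricts to a biholomorphic map onto an open set. -/
def LocallyBiholomorphicOn {n : ℕ} (f : (Fin n → ℂ) → (Fin n → ℂ)) (Ω : Set (Fin n → ℂ)) : Prop :=
  ∀ z ∈ Ω, ∃ e : OpenPartialHomeomorph (Fin n → ℂ) (Fin n → ℂ),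
    z ∈ e.source ∧ e.source ⊆ Ω ∧ Set.EqOn f e e.source ∧
      DifferentiableOn ℂ e e.source ∧ DifferentiableOn ℂ e.symm e.target

/-- The complex partial derivative `∂g/∂z_i`. -/
def pderiv {n : ℕ} (i : Fin n) (g : (Fin n → ℂ) → ℂ) (z : Fin n → ℂ) : ℂ :=
  fderiv ℂ g z (Pi.single i 1)

/-- The Jacobian matrix `(∂f_l/∂z_i)`, with row index `l` and column index `i`. -/
def jacobianMatrix {n : ℕ} (f : (Fin n → ℂ) → (Fin n → ℂ)) (z : Fin n → ℂ) :
    Matrix (Fin n) (Fin n) ℂ :=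
  Matrix.of fun l i => pderiv i (fun w => f w l) z

/-- The complex Jacobian `J_f = det Df`. -/
def jacobian {n : ℕ} (f : (Fin n → ℂ) → (Fin n → ℂ)) (z : Fin n → ℂ) : ℂ :=
  (jacobianMatrix f z).det

/-- The Schwarzian derivatives
`S^k_{ij} f = ∑_l (∂²f_l/∂z_i∂z_j) (∂z_k/∂f_l) - (δ^k_i ∂_j + δ^k_j ∂_i) log J_f / (n + 1)`.
Here `∂z_k/∂f_l` is the entry `(k, l)` of the inverse of the Jacobian matrix, and `∂_j log J_f`
is the logarithmic derivative `∂_j J_f / J_f`, the value for every local branch of the logarithm. -/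
def schwarzian {n : ℕ} (f : (Fin n → ℂ) → (Fin n → ℂ)) (k i j : Fin n) (z : Fin n → ℂ) : ℂ :=
  ∑ l, pderiv i (fun w => pderiv j (fun x => f x l) w) z * (jacobianMatrix f z)⁻¹ k l
    - 1 / ((n : ℂ) + 1) *
      ((if k = i then pderiv j (jacobian f) z / jacobian f z else 0)
        + (if k = j then pderiv i (jacobian f) z / jacobian f z else 0))

/-- The Schwarzian derivative operator `S_f(z)`, whose `k`-th component at `v` is
`vᵗ (S^k_{ij} f(z))_{ij} v`. -/
def schwarzianOp {n : ℕ} (f : (Fin n → ℂ) → (Fin n → ℂ)) (z v : Fin n → ℂ) : Fin n → ℂ :=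
  fun k => ∑ i, ∑ j, v i * schwarzian f k i j z * v j

/-- The Bergman norm of a tangent vector `v` to the polydisk at `z`. -/
def bergmanNorm {n : ℕ} (z v : Fin n → ℂ) : ℝ :=
  Real.sqrt (2 * ∑ i, ‖v i‖ ^ 2 / (1 - ‖z i‖ ^ 2) ^ 2)

/-- `‖S_f(z)‖`, the supremum of the Bergman norm of `S_f(z)(v)` over Bergman unit vectors `v`. -/
def schwarzianNormAt {n : ℕ} (f : (Fin n → ℂ) → (Fin n → ℂ)) (z : Fin n → ℂ) : ℝ≥0∞ :=
  ⨆ v : {v : Fin n → ℂ // bergmanNorm z v = 1}, ENNReal.ofReal (bergmanNorm z (schwarzianOp f z v))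

/-- `‖S_f‖`, the supremum of `‖S_f(z)‖` over the polydisk (possibly infinite). -/
def schwarzianNorm {n : ℕ} (f : (Fin n → ℂ) → (Fin n → ℂ)) : ℝ≥0∞ :=
  ⨆ z : polydisk n, schwarzianNormAt f z

/-- The family `𝓕_α` of locally biholomorphic maps of the polydisk into `ℂⁿ` with `f(0) = 0`,
`Df(0) = I` and `‖S_f‖ ≤ α`. Maps are represented by functions on `ℂⁿ` of which only the
restriction to the polydisk matters. -/
def family (n : ℕ) (α : ℝ) : Set ((Fin n → ℂ) → (Fin n → ℂ)) :=
  {f | LocallyBiholomorphicOn f (polydisk n) ∧ f 0 = 0 ∧ jacobianMatrix f 0 = 1 ∧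
    schwarzianNorm f ≤ ENNReal.ofReal α}

/-- The Euclidean norm `|∇g(z)|` of the complex gradient `(∂g/∂z_1, …, ∂g/∂z_n)`. -/
def gradNorm {n : ℕ} (g : (Fin n → ℂ) → ℂ) (z : Fin n → ℂ) : ℝ :=
  Real.sqrt (∑ i, ‖pderiv i g z‖ ^ 2)

/-- The order `λ_α = sup_{f ∈ 𝓕_α} |∇J_f(0)|`, as an extended nonnegative real. -/
def order (n : ℕ) (α : ℝ) : ℝ≥0∞ :=
  ⨆ f : family n α, ENNReal.ofReal (gradNorm (jacobian f.1) 0)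

end PolydiskSchwarzian

end

/-! Put `a = ∇ log J_f / (n + 1)`. The symbols `Γ^k_ij` of the flat connection pulled back by `f`
split as `S^k_ij + δ^k_i a_j + δ^k_j a_i`. Flatness of `Γ`, read with upper index `m ≠ j` (possible
because `n ≥ 2`), becomes a Riccati system `∂_j a_i = a_i a_j + ∑_k a_k S^k_ij + Q_ij`, with `Q`
built from `S`, products of its entries and its first derivatives (`pderiv_logJacobianGrad`). The
bound on `‖S_f‖` gives `S = O(α)` and, by Cauchy's estimate, `Q = O(α(1 + α))` on a smaller polydisk
(`norm_curvature_le`).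

Choose unimodular `v_j` with `v_j a_j(0) = |a_j(0)|`, let `A = ∑ |a_j(0)|`, and restrict to the disk
`ζ ↦ ζ v`. With `u = exp(-∫ ∑ v_j a_j)` and `p = -u a` the system becomes linear
(`exists_linearization`), and `u` never vanishes. If `S = 0`, then `u = 1 - Aζ`, so its zero `1/A`
must lie outside the open disk. In general `u` stays close to `1 - Aζ` on a disk of radius `ρ`
comparable to `min(1, 1/α)`, and a Rouché-type argument gives `ρ A < 3/2`
(`riccati_initial_value_bound`).

Hence `A ≤ 2` when `Cα ≤ 1`, and `A ≤ 2 + 3Cα` otherwise, where `C = 10^7 n^4`. In the second case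
`Cα ≤ (Cα)^(1+σ)`. Finally `|∇J_f(0)| ≤ (n + 1) A`. -/

namespace PolydiskSchwarzian

/-! ### Cauchy estimates and holomorphy of derivatives in several variables. -/

section SeveralVariables

open Metric Filter Topology Complex MeasureTheory

variable {E : Type*} [NormedAddCommGroup E] [NormedSpace ℂ E]

/-- The slice of a holomorphic function along a complex line is holomorphic, and its derivative is
a directional derivative. -/
theorem hasDerivAt_slice {g : E → ℂ} {z v : E} {ζ : ℂ} (hg : DifferentiableAt ℂ g (z + ζ • v)) :
    HasDerivAt (fun ξ : ℂ => g (z + ξ • v)) (fderiv ℂ g (z + ζ • v) v) ζ := by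
  have h : HasDerivAt (fun ξ : ℂ => z + ξ • v) v ζ := by
    simpa using ((hasDerivAt_id ζ).smul_const v).const_add z
  exact hg.hasFDerivAt.comp_hasDerivAt ζ h

/-- Cauchy's estimate for directional derivatives. -/
theorem norm_fderiv_apply_le {g : E → ℂ} {z v : E} {r C : ℝ} (hr : 0 < r)
    (hd : ∀ ζ : ℂ, ‖ζ‖ ≤ r → DifferentiableAt ℂ g (z + ζ • v))
    (hC : ∀ ζ : ℂ, ‖ζ‖ ≤ r → ‖g (z + ζ • v)‖ ≤ C) : ‖fderiv ℂ g z v‖ ≤ C / r := by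
  have h0 : deriv (fun ξ : ℂ => g (z + ξ • v)) 0 = fderiv ℂ g z v := by
    simpa using (hasDerivAt_slice (hd 0 (by simpa using hr.le))).deriv
  rw [← h0]
  refine norm_deriv_le_of_forall_mem_sphere_norm_le hr ?_ fun ζ hζ => ?_
  · refine DifferentiableOn.diffContOnCl fun ζ hζ => ?_
    have hζ' : ‖ζ‖ ≤ r := by simpa using closure_ball_subset_closedBall hζ
    exact (hasDerivAt_slice (hd ζ hζ')).differentiableAt.differentiableWithinAt
  · exact hC ζ (by simpa using (mem_sphere.1 hζ).le)

/-- Cauchy's integral formula for directional derivatives. -/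
theorem fderiv_apply_eq_circleIntegral {g : E → ℂ} {z v : E} {r : ℝ} (hr : 0 < r)
    (hd : ∀ ζ : ℂ, ‖ζ‖ ≤ r → DifferentiableAt ℂ g (z + ζ • v)) :
    fderiv ℂ g z v = (2 * Real.pi * I)⁻¹ *
      ∫ θ in (0 : ℝ)..2 * Real.pi, (deriv (circleMap 0 r) θ * (1 / (circleMap 0 r θ) ^ 2)) *
        g (z + circleMap 0 r θ • v) := by
  have h0 : deriv (fun ξ : ℂ => g (z + ξ • v)) 0 = fderiv ℂ g z v := by
    simpa using (hasDerivAt_slice (hd 0 (by simpa using hr.le))).deriv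
  have h := DifferentiableOn.deriv_eq_smul_circleIntegral (f := fun ξ : ℂ => g (z + ξ • v))
    (c := 0) hr fun ζ hζ => (hasDerivAt_slice
      (hd ζ (by simpa using hζ))).differentiableAt.differentiableWithinAt
  rw [h0] at h
  rw [eq_inv_mul_iff_mul_eq₀ two_pi_I_ne_zero]
  rw [← smul_eq_mul, ← h, circleIntegral]
  simp only [smul_eq_mul, sub_zero, mul_assoc]

/-- Differentiation under the integral sign for averages of translates of a holomorphic function. -/
theorem differentiableAt_integral_translates [FiniteDimensional ℂ E] {g : E → ℂ} {z₀ : E}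
    {R M B : ℝ} (hR : 0 < R) (hg : ∀ z ∈ ball z₀ (3 * R), DifferentiableAt ℂ g z)
    (hM : ∀ z ∈ ball z₀ (3 * R), ‖g z‖ ≤ M) {c : ℝ → ℂ} {γ : ℝ → E} (hc : Continuous c)
    (hγ : Continuous γ) (hcB : ∀ θ, ‖c θ‖ ≤ B) (hγR : ∀ θ, ‖γ θ‖ ≤ R) (a b : ℝ) :
    DifferentiableAt ℂ (fun z => ∫ θ in a..b, c θ * g (z + γ θ)) z₀ := by
  borelize E
  have : ProperSpace E := FiniteDimensional.proper ℂ E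
  have hmem : ∀ z ∈ ball z₀ R, ∀ θ, z + γ θ ∈ ball z₀ (2 * R) := by
    intro z hz θ
    rw [mem_ball, dist_eq_norm] at hz ⊢
    calc ‖z + γ θ - z₀‖ = ‖(z - z₀) + γ θ‖ := by congr 1; abel
      _ ≤ ‖z - z₀‖ + ‖γ θ‖ := norm_add_le _ _
      _ < 2 * R := by linarith [hγR θ]
  have hsub : ball z₀ (2 * R) ⊆ ball z₀ (3 * R) := ball_subset_ball (by linarith)
  have hM0 : 0 ≤ M := (norm_nonneg _).trans (hM z₀ (mem_ball_self (by linarith)))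
  have hB0 : 0 ≤ B := (norm_nonneg _).trans (hcB 0)
  -- Cauchy's estimate on the disk of radius `R / (2‖v‖)` in direction `v`, which stays in the ball
  -- of radius `3R`.
  have hbd : ∀ z ∈ ball z₀ (2 * R), ‖fderiv ℂ g z‖ ≤ 2 * M / R := by
    intro z hz
    refine ContinuousLinearMap.opNorm_le_bound _ (by positivity) fun v => ?_
    rcases eq_or_ne v 0 with rfl | hv
    · simp
    have hv' : 0 < ‖v‖ := norm_pos_iff.2 hv
    have hline : ∀ ζ : ℂ, ‖ζ‖ ≤ R / (2 * ‖v‖) → z + ζ • v ∈ ball z₀ (3 * R) := by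
      intro ζ hζ
      rw [mem_ball, dist_eq_norm] at hz ⊢
      have h1 : ‖ζ • v‖ ≤ R / 2 := by
        rw [norm_smul]
        calc ‖ζ‖ * ‖v‖ ≤ R / (2 * ‖v‖) * ‖v‖ := by gcongr
          _ = R / 2 := by field_simp
      calc ‖z + ζ • v - z₀‖ = ‖(z - z₀) + ζ • v‖ := by congr 1; abel
        _ ≤ ‖z - z₀‖ + ‖ζ • v‖ := norm_add_le _ _
        _ < 3 * R := by linarith
    have := norm_fderiv_apply_le (g := g) (z := z) (v := v) (r := R / (2 * ‖v‖)) (C := M)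
      (by positivity) (fun ζ hζ => hg _ (hline ζ hζ)) fun ζ hζ => hM _ (hline ζ hζ)
    refine this.trans (le_of_eq ?_)
    field_simp
  have hcont : ∀ z ∈ ball z₀ R, Continuous fun θ => c θ * g (z + γ θ) := by
    intro z hz
    refine hc.mul (continuous_iff_continuousAt.2 fun θ => ?_)
    exact ContinuousAt.comp (g := g) (hg _ (hsub (hmem z hz θ))).continuousAt
      (continuous_const.add hγ).continuousAt
  have hball : ball z₀ R ∈ 𝓝 z₀ := ball_mem_nhds _ hR
  refine (intervalIntegral.hasFDerivAt_integral_of_dominated_of_fderiv_le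
    (F' := fun z θ => c θ • fderiv ℂ g (z + γ θ)) (bound := fun _ => B * (2 * M / R))
    hball ?_ ?_ ?_ ?_ ?_ ?_).differentiableAt
  · filter_upwards [hball] with z hz using (hcont z hz).aestronglyMeasurable
  · exact (hcont z₀ (mem_ball_self hR)).intervalIntegrable _ _
  -- Measurability of `fderiv` holds for every function, so continuity of the derivative is not
  -- presupposed.
  · have hm : Measurable fun θ => fderiv ℂ g (z₀ + γ θ) :=
      (measurable_fderiv ℂ g).comp (continuous_const.add hγ).measurable
    exact hc.aestronglyMeasurable.smul hm.aestronglyMeasurable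
  · refine Eventually.of_forall fun θ _ z hz => ?_
    rw [norm_smul]
    exact mul_le_mul (hcB θ) (hbd _ (hmem z hz θ)) (norm_nonneg _) hB0
  · exact intervalIntegrable_const
  · refine Eventually.of_forall fun θ _ z hz => ?_
    have h1 : HasFDerivAt (fun x => g (x + γ θ)) (fderiv ℂ g (z + γ θ)) z :=
      (hasFDerivAt_comp_add_right (γ θ)).2 (hg _ (hsub (hmem z hz θ))).hasFDerivAt
    exact h1.const_mul (c θ)

/-- Directional derivatives of a holomorphic function of several variables are holomorphic. -/
theorem differentiableAt_fderiv_apply [FiniteDimensional ℂ E] {g : E → ℂ} {z₀ : E} (v : E)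
    (hg : ∀ᶠ z in 𝓝 z₀, DifferentiableAt ℂ g z) :
    DifferentiableAt ℂ (fun z => fderiv ℂ g z v) z₀ := by
  have hb : ∀ᶠ z in 𝓝 z₀, ‖g z‖ ≤ ‖g z₀‖ + 1 :=
    (hg.self_of_nhds.continuousAt.norm.eventually_lt continuousAt_const
      (lt_add_one ‖g z₀‖)).mono fun _ h => h.le
  obtain ⟨ε, hε, h⟩ := Metric.eventually_nhds_iff_ball.1 (hg.and hb)
  have hR : 0 < ε / 3 := by positivity
  -- The `+ 1` covers `v = 0`; the circle `r e^{iθ} v` stays within `ε / 3`.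
  set r : ℝ := ε / 3 / (‖v‖ + 1) with hr
  have hr0 : 0 < r := by positivity
  have h3 : 3 * (ε / 3) = ε := by ring
  have hrv : r * ‖v‖ ≤ ε / 3 := by
    rw [hr, div_mul_eq_mul_div, div_le_iff₀ (by positivity)]
    nlinarith [norm_nonneg v]
  have hγ : ∀ θ, ‖circleMap 0 r θ • v‖ ≤ ε / 3 := by
    intro θ
    rw [norm_smul, norm_circleMap_zero, abs_of_pos hr0]
    exact hrv
  have hne : ∀ θ, circleMap 0 r θ ≠ 0 := fun θ => circleMap_ne_center hr0.ne'
  have key := differentiableAt_integral_translates (g := g) (z₀ := z₀) (M := ‖g z₀‖ + 1)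
    (B := r * (1 / r ^ 2))
    (c := fun θ => deriv (circleMap 0 r) θ * (1 / (circleMap 0 r θ) ^ 2))
    (γ := fun θ => circleMap 0 r θ • v) hR
    (fun z hz => (h z (by rwa [h3] at hz)).1) (fun z hz => (h z (by rwa [h3] at hz)).2)
    (by
      simp only [deriv_circleMap]
      refine Continuous.mul (by fun_prop) (continuous_const.div (by fun_prop) fun θ => ?_)
      exact pow_ne_zero _ (hne θ))
    (by fun_prop)
    (fun θ => by
      simp [deriv_circleMap, norm_circleMap_zero, abs_of_pos hr0]) hγ 0 (2 * Real.pi)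
  refine (key.const_mul (2 * Real.pi * I)⁻¹).congr_of_eventuallyEq ?_
  filter_upwards [ball_mem_nhds z₀ hR] with z hz
  refine fderiv_apply_eq_circleIntegral hr0 fun ζ hζ => (h _ ?_).1
  rw [mem_ball, dist_eq_norm] at hz ⊢
  have h1 : ‖ζ • v‖ ≤ ε / 3 := by
    rw [norm_smul]
    exact (mul_le_mul_of_nonneg_right hζ (norm_nonneg v)).trans hrv
  calc ‖z + ζ • v - z₀‖ = ‖(z - z₀) + ζ • v‖ := by congr 1; abel
    _ ≤ ‖z - z₀‖ + ‖ζ • v‖ := norm_add_le _ _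
    _ < ε := by linarith

end SeveralVariables

/-! ### Calculus of complex partial derivatives on the polydisk. -/

section PartialDerivatives

open Filter Topology

variable {n : ℕ}

theorem isOpen_polydisk (n : ℕ) : IsOpen (polydisk n) := by
  have : polydisk n = ⋂ i, {z : Fin n → ℂ | ‖z i‖ < 1} := by
    ext z
    simp [polydisk]
  rw [this]
  exact isOpen_iInter_of_finite fun i => isOpen_lt (by fun_prop) continuous_const

theorem polydisk_mem_nhds {z : Fin n → ℂ} (hz : z ∈ polydisk n) : polydisk n ∈ 𝓝 z :=
  (isOpen_polydisk n).mem_nhds hz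

theorem pderiv_congr {g h : (Fin n → ℂ) → ℂ} {z : Fin n → ℂ} (i : Fin n) (hgh : g =ᶠ[𝓝 z] h) :
    pderiv i g z = pderiv i h z := by
  rw [pderiv, pderiv, hgh.fderiv_eq]

theorem pderiv_congr_of_eqOn {g h : (Fin n → ℂ) → ℂ} {z : Fin n → ℂ} (i : Fin n)
    (hgh : Set.EqOn g h (polydisk n)) (hz : z ∈ polydisk n) : pderiv i g z = pderiv i h z :=
  pderiv_congr i (hgh.eventuallyEq_of_mem (polydisk_mem_nhds hz))

theorem pderiv_add {g h : (Fin n → ℂ) → ℂ} {z : Fin n → ℂ} (i : Fin n)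
    (hg : DifferentiableAt ℂ g z) (hh : DifferentiableAt ℂ h z) :
    pderiv i (fun w => g w + h w) z = pderiv i g z + pderiv i h z := by
  simp only [pderiv]
  rw [fderiv_fun_add hg hh]
  rfl

theorem pderiv_mul {g h : (Fin n → ℂ) → ℂ} {z : Fin n → ℂ} (i : Fin n)
    (hg : DifferentiableAt ℂ g z) (hh : DifferentiableAt ℂ h z) :
    pderiv i (fun w => g w * h w) z = pderiv i g z * h z + g z * pderiv i h z := by
  simp only [pderiv]
  rw [fderiv_fun_mul hg hh]
  simp [mul_comm, add_comm]

theorem pderiv_sum {ι : Type*} {s : Finset ι} {g : ι → (Fin n → ℂ) → ℂ} {z : Fin n → ℂ} (i : Fin n)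
    (hg : ∀ k ∈ s, DifferentiableAt ℂ (g k) z) :
    pderiv i (fun w => ∑ k ∈ s, g k w) z = ∑ k ∈ s, pderiv i (g k) z := by
  simp only [pderiv]
  rw [fderiv_fun_sum hg]
  simp

theorem fderiv_apply_eq_sum (g : (Fin n → ℂ) → ℂ) (z v : Fin n → ℂ) :
    fderiv ℂ g z v = ∑ j, v j * pderiv j g z := by
  conv_lhs => rw [pi_eq_sum_univ' v]
  simp [pderiv, map_sum]

theorem differentiableAt_pderiv {g : (Fin n → ℂ) → ℂ} {z : Fin n → ℂ} (i : Fin n)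
    (hg : ∀ᶠ w in 𝓝 z, DifferentiableAt ℂ g w) : DifferentiableAt ℂ (pderiv i g) z :=
  differentiableAt_fderiv_apply _ hg

theorem differentiableOn_pderiv {g : (Fin n → ℂ) → ℂ} (i : Fin n)
    (hg : DifferentiableOn ℂ g (polydisk n)) : DifferentiableOn ℂ (pderiv i g) (polydisk n) :=
  fun _ hz => (differentiableAt_pderiv i
    (hg.eventually_differentiableAt (polydisk_mem_nhds hz))).differentiableWithinAt

/-- Mixed partial derivatives of a holomorphic function commute. -/
theorem pderiv_comm {g : (Fin n → ℂ) → ℂ} {z : Fin n → ℂ}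
    (hg : DifferentiableOn ℂ g (polydisk n)) (hz : z ∈ polydisk n) (i j : Fin n) :
    pderiv i (pderiv j g) z = pderiv j (pderiv i g) z := by
  have hev := hg.eventually_differentiableAt (polydisk_mem_nhds hz)
  -- Symmetry of second derivatives requires `fderiv ℂ g` to be differentiable; it is a sum of fixed
  -- projections with holomorphic coefficients.
  have hpi : fderiv ℂ g = fun w => ∑ k, pderiv k g w • ContinuousLinearMap.proj (R := ℂ)
      (φ := fun _ : Fin n => ℂ) k := by
    funext w
    ext v
    rw [fderiv_apply_eq_sum]
    simp [mul_comm]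
  have hdf : DifferentiableAt ℂ (fderiv ℂ g) z := by
    rw [hpi]
    exact DifferentiableAt.fun_sum fun k _ => (differentiableAt_pderiv k hev).smul_const _
  have hsym := second_derivative_symmetric_of_eventually (f := g) (f' := fderiv ℂ g)
    (hev.mono fun w hw => hw.hasFDerivAt) hdf.hasFDerivAt
  have hcomp : ∀ k l : Fin n, pderiv k (pderiv l g) z
      = fderiv ℂ (fderiv ℂ g) z (Pi.single k 1) (Pi.single l 1) := by
    intro k l
    have := hdf.hasFDerivAt.clm_apply (hasFDerivAt_const (Pi.single l (1 : ℂ)) z)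
    change fderiv ℂ (fun w => fderiv ℂ g w (Pi.single l 1)) z _ = _
    rw [this.fderiv]
    simp
  rw [hcomp, hcomp, hsym]

end PartialDerivatives

/-! ### Determinants and inverses of holomorphic matrices. -/

section MatrixFunctions

variable {n : ℕ}

theorem differentiableAt_det {A : (Fin n → ℂ) → Matrix (Fin n) (Fin n) ℂ} {z : Fin n → ℂ}
    (hA : ∀ k l, DifferentiableAt ℂ (fun w => A w k l) z) :
    DifferentiableAt ℂ (fun w => (A w).det) z := by
  simp only [Matrix.det_apply]
  refine DifferentiableAt.fun_sum fun τ _ => DifferentiableAt.const_smul ?_ _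
  exact (HasFDerivAt.finsetProd (g := fun k w => A w (τ k) k)
    fun k _ => (hA (τ k) k).hasFDerivAt).differentiableAt

theorem differentiableAt_inv_apply {A : (Fin n → ℂ) → Matrix (Fin n) (Fin n) ℂ} {z : Fin n → ℂ}
    (hA : ∀ k l, DifferentiableAt ℂ (fun w => A w k l) z) (h0 : (A z).det ≠ 0) (k l : Fin n) :
    DifferentiableAt ℂ (fun w => (A w)⁻¹ k l) z := by
  simp only [Matrix.inv_def, Ring.inverse_eq_inv', Matrix.smul_apply, smul_eq_mul,
    Matrix.adjugate_apply]
  refine (((differentiableAt_det hA).inv h0)).mul (differentiableAt_det fun p q => ?_)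
  by_cases hp : p = l
  · subst hp
    simp
  · simpa [Matrix.updateRow_ne hp] using hA p q

end MatrixFunctions

/-! ### Holomorphy and nondegeneracy of the Jacobian matrix. -/

section LocallyBiholomorphic

variable {n : ℕ} {f : (Fin n → ℂ) → (Fin n → ℂ)}

theorem LocallyBiholomorphicOn.differentiableOn (hf : LocallyBiholomorphicOn f (polydisk n)) :
    DifferentiableOn ℂ f (polydisk n) := by
  intro z hz
  obtain ⟨e, hze, -, heq, he, -⟩ := hf z hz
  have hn := e.open_source.mem_nhds hze
  exact ((he.differentiableAt hn).congr_of_eventuallyEq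
    (heq.eventuallyEq_of_mem hn)).differentiableWithinAt

theorem LocallyBiholomorphicOn.differentiableOn_apply
    (hf : LocallyBiholomorphicOn f (polydisk n)) (l : Fin n) :
    DifferentiableOn ℂ (fun z => f z l) (polydisk n) :=
  differentiableOn_pi.1 hf.differentiableOn l

theorem jacobianMatrix_mulVec {z : Fin n → ℂ} (hd : DifferentiableAt ℂ f z) (v : Fin n → ℂ) :
    (jacobianMatrix f z).mulVec v = fderiv ℂ f z v := by
  funext l
  have h : fderiv ℂ (fun w => f w l) z v = fderiv ℂ f z v l := by
    rw [(hasFDerivAt_pi'.1 hd.hasFDerivAt l).fderiv]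
    rfl
  rw [← h, fderiv_apply_eq_sum]
  simp [Matrix.mulVec, dotProduct, jacobianMatrix, mul_comm]

/-- The chain rule for `e.symm ∘ e = id` near `z` makes `Df(z)` injective, so its matrix has no
kernel. -/
theorem LocallyBiholomorphicOn.jacobian_ne_zero (hf : LocallyBiholomorphicOn f (polydisk n))
    {z : Fin n → ℂ} (hz : z ∈ polydisk n) : jacobian f z ≠ 0 := by
  obtain ⟨e, hze, -, heq, he, he'⟩ := hf z hz
  have hn := e.open_source.mem_nhds hze
  have hev := heq.eventuallyEq_of_mem hn
  have hez := he.differentiableAt hn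
  have hes := he'.differentiableAt (e.open_target.mem_nhds (e.map_source hze))
  have hinj : ∀ v, fderiv ℂ f z v = 0 → v = 0 := by
    intro v hv
    have h1 : HasFDerivAt (e.symm ∘ e) ((fderiv ℂ e.symm (e z)).comp (fderiv ℂ e z)) z :=
      hes.hasFDerivAt.comp z hez.hasFDerivAt
    have h2 : HasFDerivAt (e.symm ∘ e) (ContinuousLinearMap.id ℂ (Fin n → ℂ)) z := by
      refine (hasFDerivAt_id z).congr_of_eventuallyEq ?_
      filter_upwards [hn] with w hw using e.left_inv hw
    have h3 := congrArg (fun T : (Fin n → ℂ) →L[ℂ] (Fin n → ℂ) => T v) (h1.unique h2)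
    rw [hev.fderiv_eq] at hv
    simpa [hv] using h3.symm
  intro hdet
  obtain ⟨v, hv, hv0⟩ := Matrix.exists_mulVec_eq_zero_iff.2 hdet
  rw [jacobianMatrix_mulVec (hez.congr_of_eventuallyEq hev)] at hv0
  exact hv (hinj v hv0)

theorem LocallyBiholomorphicOn.differentiableOn_jacobianMatrix
    (hf : LocallyBiholomorphicOn f (polydisk n)) (l i : Fin n) :
    DifferentiableOn ℂ (fun z => jacobianMatrix f z l i) (polydisk n) :=
  differentiableOn_pderiv i (hf.differentiableOn_apply l)

theorem LocallyBiholomorphicOn.differentiableOn_jacobian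
    (hf : LocallyBiholomorphicOn f (polydisk n)) :
    DifferentiableOn ℂ (jacobian f) (polydisk n) := fun _ hz =>
  (differentiableAt_det fun k l => (hf.differentiableOn_jacobianMatrix k l).differentiableAt
    (polydisk_mem_nhds hz)).differentiableWithinAt

theorem LocallyBiholomorphicOn.differentiableOn_jacobianMatrix_inv
    (hf : LocallyBiholomorphicOn f (polydisk n)) (k l : Fin n) :
    DifferentiableOn ℂ (fun z => (jacobianMatrix f z)⁻¹ k l) (polydisk n) := fun _ hz =>
  (differentiableAt_inv_apply (fun k l => (hf.differentiableOn_jacobianMatrix k l).differentiableAt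
    (polydisk_mem_nhds hz)) (hf.jacobian_ne_zero hz) k l).differentiableWithinAt

end LocallyBiholomorphic

/-! ### The pulled-back flat connection and the Riccati system for `∇ log J_f`. -/

noncomputable section Connection

variable {n : ℕ} {f : (Fin n → ℂ) → (Fin n → ℂ)} {z : Fin n → ℂ}

/-- The Christoffel symbols `Γ^k_ij = ∑_l (∂²f_l/∂z_i∂z_j) (∂z_k/∂f_l)` of the flat connection
pulled back by `f`. -/
def christoffel (f : (Fin n → ℂ) → (Fin n → ℂ)) (k i j : Fin n) (z : Fin n → ℂ) : ℂ :=
  ∑ l, pderiv i (pderiv j fun x => f x l) z * (jacobianMatrix f z)⁻¹ k l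

/-- The gradient of `log J_f / (n + 1)`. -/
def logJacobianGrad (f : (Fin n → ℂ) → (Fin n → ℂ)) (i : Fin n) (z : Fin n → ℂ) : ℂ :=
  1 / ((n : ℂ) + 1) * (pderiv i (jacobian f) z / jacobian f z)

/-- This splitting lets the bounded tensor `S` serve as coefficients and `a = logJacobianGrad f` as
the unknown. -/
theorem christoffel_eq (f : (Fin n → ℂ) → (Fin n → ℂ)) (k i j : Fin n) (z : Fin n → ℂ) :
    christoffel f k i j z = schwarzian f k i j z
      + ((if k = i then logJacobianGrad f j z else 0)
        + (if k = j then logJacobianGrad f i z else 0)) := by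
  have h : schwarzian f k i j z = christoffel f k i j z - 1 / ((n : ℂ) + 1) *
      ((if k = i then pderiv j (jacobian f) z / jacobian f z else 0)
        + (if k = j then pderiv i (jacobian f) z / jacobian f z else 0)) := rfl
  rw [h]
  simp only [logJacobianGrad]
  split_ifs <;> ring

theorem schwarzian_eq (f : (Fin n → ℂ) → (Fin n → ℂ)) (k i j : Fin n) :
    schwarzian f k i j = fun z => christoffel f k i j z -
      ((if k = i then logJacobianGrad f j z else 0)
        + (if k = j then logJacobianGrad f i z else 0)) := by
  funext z
  rw [christoffel_eq]
  ring

variable (hf : LocallyBiholomorphicOn f (polydisk n))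
include hf

theorem LocallyBiholomorphicOn.differentiableOn_christoffel (k i j : Fin n) :
    DifferentiableOn ℂ (christoffel f k i j) (polydisk n) := by
  unfold christoffel
  exact DifferentiableOn.fun_sum fun l _ =>
    (differentiableOn_pderiv i (differentiableOn_pderiv j (hf.differentiableOn_apply l))).mul
      (hf.differentiableOn_jacobianMatrix_inv k l)

theorem LocallyBiholomorphicOn.differentiableOn_logJacobianGrad (i : Fin n) :
    DifferentiableOn ℂ (logJacobianGrad f i) (polydisk n) := by
  unfold logJacobianGrad
  simp only [div_eq_mul_inv]
  exact ((differentiableOn_pderiv i hf.differentiableOn_jacobian).mul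
    (hf.differentiableOn_jacobian.inv fun _ hz => hf.jacobian_ne_zero hz)).const_mul _

theorem LocallyBiholomorphicOn.differentiableOn_schwarzian (k i j : Fin n) :
    DifferentiableOn ℂ (schwarzian f k i j) (polydisk n) := by
  rw [schwarzian_eq]
  refine (hf.differentiableOn_christoffel k i j).sub (DifferentiableOn.add ?_ ?_)
  · split_ifs
    · exact hf.differentiableOn_logJacobianGrad j
    · exact differentiableOn_const 0
  · split_ifs
    · exact hf.differentiableOn_logJacobianGrad i
    · exact differentiableOn_const 0

theorem LocallyBiholomorphicOn.christoffel_symm (hz : z ∈ polydisk n) (k i j : Fin n) :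
    christoffel f k i j z = christoffel f k j i z := by
  unfold christoffel
  refine Finset.sum_congr rfl fun l _ => ?_
  rw [pderiv_comm (hf.differentiableOn_apply l) hz]

theorem LocallyBiholomorphicOn.schwarzian_symm (hz : z ∈ polydisk n) (k i j : Fin n) :
    schwarzian f k i j z = schwarzian f k j i z := by
  simp only [schwarzian_eq]
  rw [hf.christoffel_symm hz k i j]
  ring

theorem LocallyBiholomorphicOn.jacobianMatrix_mul_inv (hz : z ∈ polydisk n) :
    jacobianMatrix f z * (jacobianMatrix f z)⁻¹ = 1 :=
  Matrix.mul_nonsing_inv _ (isUnit_iff_ne_zero.2 (hf.jacobian_ne_zero hz))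

/-- The equation `∂_i ∂_j f_l = ∑_k (∂_k f_l) Γ^k_ij`. -/
theorem LocallyBiholomorphicOn.pderiv_pderiv_eq (hz : z ∈ polydisk n) (l i j : Fin n) :
    pderiv i (pderiv j fun x => f x l) z
      = ∑ k, pderiv k (fun x => f x l) z * christoffel f k i j z := by
  have h : ∀ q : Fin n, ∑ k, pderiv k (fun x => f x l) z * (jacobianMatrix f z)⁻¹ k q
      = if l = q then 1 else 0 := by
    intro q
    have := congrFun (congrFun (hf.jacobianMatrix_mul_inv hz) l) q
    rwa [Matrix.mul_apply, Matrix.one_apply] at this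
  simp only [christoffel, Finset.mul_sum]
  rw [Finset.sum_comm]
  have h2 : ∀ q : Fin n, ∑ k, pderiv k (fun x => f x l) z *
      (pderiv i (pderiv j fun x => f x q) z * (jacobianMatrix f z)⁻¹ k q)
      = pderiv i (pderiv j fun x => f x q) z * if l = q then 1 else 0 := by
    intro q
    rw [← h q, Finset.mul_sum]
    exact Finset.sum_congr rfl fun k _ => by ring
  simp [h2]

/-- Flatness of the connection: `∂_m Γ^q_ij + ∑_k Γ^q_mk Γ^k_ij` is symmetric in `m` and `j`. -/
theorem LocallyBiholomorphicOn.christoffel_flat (hz : z ∈ polydisk n) (q i j m : Fin n) :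
    pderiv m (christoffel f q i j) z + ∑ k, christoffel f q m k z * christoffel f k i j z
      = pderiv j (christoffel f q i m) z
        + ∑ k, christoffel f q j k z * christoffel f k i m z := by
  -- Each side of the flatness identity is the vector that `Df` sends to third derivatives of `f`;
  -- these are symmetric in `m` and `j`, and `Df` is invertible.
  have hthird : ∀ (l i j m : Fin n), pderiv m (pderiv i (pderiv j fun x => f x l)) z
      = ∑ q, pderiv q (fun x => f x l) z * (pderiv m (christoffel f q i j) z
        + ∑ k, christoffel f q m k z * christoffel f k i j z) := by
    intro l i j m
    have hdl := hf.differentiableOn_apply l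
    have hn := polydisk_mem_nhds hz
    have hd1 : ∀ k, DifferentiableAt ℂ (pderiv k fun x => f x l) z := fun k =>
      (differentiableOn_pderiv k hdl).differentiableAt hn
    have hd2 : ∀ k, DifferentiableAt ℂ (christoffel f k i j) z := fun k =>
      (hf.differentiableOn_christoffel k i j).differentiableAt hn
    rw [pderiv_congr_of_eqOn (h := fun w => ∑ k, pderiv k (fun x => f x l) w *
        christoffel f k i j w) m (fun w hw => hf.pderiv_pderiv_eq hw l i j) hz,
      pderiv_sum m fun k _ => (hd1 k).fun_mul (hd2 k)]
    simp only [pderiv_mul m (hd1 _) (hd2 _), hf.pderiv_pderiv_eq hz l m, Finset.sum_add_distrib,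
      mul_add, Finset.mul_sum, Finset.sum_mul]
    rw [add_comm, Finset.sum_comm (f := fun k q => pderiv q (fun x => f x l) z *
      christoffel f q m k z * christoffel f k i j z)]
    simp only [mul_assoc]
  have hsymm : ∀ l, pderiv m (pderiv i (pderiv j fun x => f x l)) z
      = pderiv j (pderiv i (pderiv m fun x => f x l)) z := by
    intro l
    have hdl := hf.differentiableOn_apply l
    rw [pderiv_comm (differentiableOn_pderiv j hdl) hz m i,
      pderiv_congr_of_eqOn i (fun w hw => pderiv_comm hdl hw m j) hz,
      pderiv_comm (differentiableOn_pderiv m hdl) hz i j]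
  set X : Fin n → ℂ := fun q => pderiv m (christoffel f q i j) z
    + ∑ k, christoffel f q m k z * christoffel f k i j z with hX
  set Y : Fin n → ℂ := fun q => pderiv j (christoffel f q i m) z
    + ∑ k, christoffel f q j k z * christoffel f k i m z with hY
  have hMX : (jacobianMatrix f z).mulVec X = (jacobianMatrix f z).mulVec Y := by
    funext l
    have := hsymm l
    rw [hthird, hthird] at this
    exact this
  have hinj := Matrix.mulVec_injective_of_isUnit
    ((Matrix.isUnit_iff_isUnit_det _).2 (isUnit_iff_ne_zero.2 (hf.jacobian_ne_zero hz)))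
  exact congrFun (hinj hMX) q

/-- No branch of the logarithm is needed: differentiate `∂_j J = (n + 1) a_j J` and cancel the
symmetric product `a_j ∂_i J = a_i ∂_j J`. -/
theorem LocallyBiholomorphicOn.pderiv_logJacobianGrad_symm (hz : z ∈ polydisk n) (i j : Fin n) :
    pderiv i (logJacobianGrad f j) z = pderiv j (logJacobianGrad f i) z := by
  have hJ := hf.differentiableOn_jacobian
  have hn := polydisk_mem_nhds hz
  have hJ0 := hf.jacobian_ne_zero hz
  have key : ∀ i j : Fin n, pderiv i (pderiv j (jacobian f)) z = ((n : ℂ) + 1) *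
      (pderiv i (logJacobianGrad f j) z * jacobian f z
        + logJacobianGrad f j z * pderiv i (jacobian f) z) := by
    intro i j
    have hn1 : (n : ℂ) + 1 ≠ 0 := Nat.cast_add_one_ne_zero n
    have ha := (hf.differentiableOn_logJacobianGrad j).differentiableAt hn
    have hJz := hJ.differentiableAt hn
    rw [pderiv_congr_of_eqOn (h := fun w => ((n : ℂ) + 1) * (logJacobianGrad f j w * jacobian f w))
      i (fun w hw => ?_) hz, pderiv_mul i (differentiableAt_const _) (ha.fun_mul hJz),
      pderiv_mul i ha hJz]
    · simp [pderiv]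
    · have := hf.jacobian_ne_zero hw
      simp only [logJacobianGrad]
      field_simp
  have h := pderiv_comm hJ hz i j
  rw [key, key] at h
  have hn1 : (n : ℂ) + 1 ≠ 0 := Nat.cast_add_one_ne_zero n
  have h2 := mul_left_cancel₀ hn1 h
  have h3 : logJacobianGrad f j z * pderiv i (jacobian f) z
      = logJacobianGrad f i z * pderiv j (jacobian f) z := by
    simp only [logJacobianGrad]
    ring
  rw [h3] at h2
  exact mul_right_cancel₀ hJ0 (add_right_cancel h2)

/-- The projective structure equation: for `m ≠ j` the derivative `∂_j a_i` of
`a = ∇ log J_f / (n + 1)` is expressed by `a` and the Schwarzian derivatives. -/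
theorem LocallyBiholomorphicOn.pderiv_logJacobianGrad (hz : z ∈ polydisk n) {i j m : Fin n}
    (hmj : m ≠ j) :
    pderiv j (logJacobianGrad f i) z = logJacobianGrad f i z * logJacobianGrad f j z
      + ∑ k, logJacobianGrad f k z * schwarzian f k i j z
      + (pderiv m (schwarzian f m i j) z - pderiv j (schwarzian f m i m) z
        + ∑ k, (schwarzian f m m k z * schwarzian f k i j z
          - schwarzian f m j k z * schwarzian f k i m z)) := by
  have hn := polydisk_mem_nhds hz
  have hS : ∀ k i j, DifferentiableAt ℂ (schwarzian f k i j) z := fun k i j =>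
    (hf.differentiableOn_schwarzian k i j).differentiableAt hn
  have ha : ∀ i, DifferentiableAt ℂ (logJacobianGrad f i) z := fun i =>
    (hf.differentiableOn_logJacobianGrad i).differentiableAt hn
  have hc : ∀ (p : Prop) [Decidable p] (g : (Fin n → ℂ) → ℂ) (i : Fin n),
      pderiv i (fun w => if p then g w else 0) z = if p then pderiv i g z else 0 := by
    intro p _ g i
    split_ifs
    · rfl
    · simp [pderiv]
  have hcd : ∀ (p : Prop) [Decidable p] (i : Fin n),
      DifferentiableAt ℂ (fun w => if p then logJacobianGrad f i w else 0) z := by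
    intro p _ i
    split_ifs
    · exact ha i
    · exact differentiableAt_const 0
  have hΓ : ∀ k i j l, pderiv l (christoffel f k i j) z = pderiv l (schwarzian f k i j) z
      + ((if k = i then pderiv l (logJacobianGrad f j) z else 0)
        + (if k = j then pderiv l (logJacobianGrad f i) z else 0)) := by
    intro k i j l
    rw [funext fun w => christoffel_eq f k i j w,
      pderiv_add l (hS k i j) ((hcd _ _).fun_add (hcd _ _)), pderiv_add l (hcd _ _) (hcd _ _), hc, hc]
  -- With upper index `m`, the term `∂_j a_i` survives through `δ^m_m`, while `δ^m_j = 0`. The terms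
  -- `δ^m_i ∂_m a_j` and `δ^m_i ∂_j a_m` cancel because `a` is closed.
  have hflat := hf.christoffel_flat hz m i j m
  rw [hΓ, hΓ] at hflat
  simp only [christoffel_eq, add_mul, mul_add, Finset.sum_add_distrib, ite_mul, mul_ite, mul_zero,
    zero_mul, Finset.sum_ite_eq, Finset.sum_ite_eq', Finset.mem_univ, if_true, if_neg hmj,
    hf.pderiv_logJacobianGrad_symm hz m j, Finset.sum_const_zero] at hflat
  rw [hf.schwarzian_symm hz m j i, hf.schwarzian_symm hz m m i, hf.schwarzian_symm hz m m j]
    at hflat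
  rw [Finset.sum_sub_distrib]
  split_ifs at hflat <;> linear_combination -hflat

end Connection

/-! ### From the Bergman norm of `S_f` to bounds on the coefficients. -/

section BergmanNorm

variable {n : ℕ}

theorem bergmanNorm_nonneg (z v : Fin n → ℂ) : 0 ≤ bergmanNorm z v := Real.sqrt_nonneg _

theorem bergmanNorm_sq (z v : Fin n → ℂ) :
    bergmanNorm z v ^ 2 = 2 * ∑ i, ‖v i‖ ^ 2 / (1 - ‖z i‖ ^ 2) ^ 2 :=
  Real.sq_sqrt (by positivity)

theorem bergmanNorm_smul (c : ℂ) (z v : Fin n → ℂ) :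
    bergmanNorm z (c • v) = ‖c‖ * bergmanNorm z v := by
  rw [← abs_of_nonneg (bergmanNorm_nonneg z (c • v)),
    ← abs_of_nonneg (mul_nonneg (norm_nonneg c) (bergmanNorm_nonneg z v)), ← sq_eq_sq_iff_abs_eq_abs,
    mul_pow, bergmanNorm_sq, bergmanNorm_sq]
  simp only [Pi.smul_apply, smul_eq_mul, norm_mul, mul_pow, Finset.mul_sum]
  exact Finset.sum_congr rfl fun i _ => by ring

theorem norm_apply_le_bergmanNorm {z : Fin n → ℂ} (hz : z ∈ polydisk n) (v : Fin n → ℂ)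
    (k : Fin n) : ‖v k‖ ≤ bergmanNorm z v := by
  refine Real.le_sqrt_of_sq_le ?_
  have h1 : ‖v k‖ ^ 2 ≤ ‖v k‖ ^ 2 / (1 - ‖z k‖ ^ 2) ^ 2 := by
    have hzk := hz k
    have h0 := norm_nonneg (z k)
    have h2 : 0 < 1 - ‖z k‖ ^ 2 := by nlinarith
    exact le_div_self (sq_nonneg _) (by positivity) (pow_le_one₀ h2.le (by nlinarith))
  have h2 : ‖v k‖ ^ 2 / (1 - ‖z k‖ ^ 2) ^ 2 ≤ ∑ i, ‖v i‖ ^ 2 / (1 - ‖z i‖ ^ 2) ^ 2 :=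
    Finset.single_le_sum (f := fun i => ‖v i‖ ^ 2 / (1 - ‖z i‖ ^ 2) ^ 2)
      (fun i _ => by positivity) (Finset.mem_univ k)
  have h3 : 0 ≤ ‖v k‖ ^ 2 := by positivity
  linarith

theorem bergmanNorm_sq_le {z : Fin n → ℂ} (hz : ∀ i, ‖z i‖ ≤ 7 / 8) (v : Fin n → ℂ) :
    bergmanNorm z v ^ 2 ≤ 38 * ∑ i, ‖v i‖ ^ 2 := by
  rw [bergmanNorm_sq, Finset.mul_sum, Finset.mul_sum]
  refine Finset.sum_le_sum fun i _ => ?_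
  -- `1 - (7/8)^2 = 15/64` and `(64/15)^2 < 19`; the factor `2` of the Bergman metric makes this
  -- `38`.
  have h1 : (15 / 64 : ℝ) ≤ 1 - ‖z i‖ ^ 2 := by nlinarith [hz i, norm_nonneg (z i)]
  have h2 : ‖v i‖ ^ 2 / (1 - ‖z i‖ ^ 2) ^ 2 ≤ ‖v i‖ ^ 2 / (15 / 64) ^ 2 := by gcongr
  have h3 : ‖v i‖ ^ 2 / (15 / 64 : ℝ) ^ 2 ≤ 19 * ‖v i‖ ^ 2 := by
    have := sq_nonneg ‖v i‖
    rw [div_le_iff₀ (by norm_num)]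
    nlinarith
  linarith

theorem schwarzianOp_smul (f : (Fin n → ℂ) → (Fin n → ℂ)) (c : ℂ) (z v : Fin n → ℂ) :
    schwarzianOp f z (c • v) = (c ^ 2) • schwarzianOp f z v := by
  funext k
  simp only [schwarzianOp, Pi.smul_apply, smul_eq_mul, Finset.mul_sum]
  exact Finset.sum_congr rfl fun i _ => Finset.sum_congr rfl fun j _ => by ring

/-- The bound on Bergman unit vectors, extended to all vectors by homogeneity. -/
theorem bergmanNorm_schwarzianOp_le {f : (Fin n → ℂ) → (Fin n → ℂ)} {α : ℝ} (hα : 0 ≤ α)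
    (hf : schwarzianNorm f ≤ ENNReal.ofReal α) {z : Fin n → ℂ} (hz : z ∈ polydisk n)
    (v : Fin n → ℂ) : bergmanNorm z (schwarzianOp f z v) ≤ α * bergmanNorm z v ^ 2 := by
  rcases (bergmanNorm_nonneg z v).eq_or_lt with h0 | h0
  · have hv : v = 0 := by
      funext k
      have := norm_apply_le_bergmanNorm hz v k
      rw [← h0] at this
      simpa using this
    have h1 : schwarzianOp f z v = 0 := by
      funext k
      simp [schwarzianOp, hv]
    rw [h1, ← h0]
    simp [bergmanNorm]
  · set B := bergmanNorm z v with hB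
    have hc : ‖((B⁻¹ : ℝ) : ℂ)‖ = B⁻¹ := by
      rw [Complex.norm_real, Real.norm_of_nonneg (inv_nonneg.2 h0.le)]
    have hunit : bergmanNorm z (((B⁻¹ : ℝ) : ℂ) • v) = 1 := by
      rw [bergmanNorm_smul, hc, ← hB, inv_mul_cancel₀ h0.ne']
    have h1 : ENNReal.ofReal (bergmanNorm z (schwarzianOp f z (((B⁻¹ : ℝ) : ℂ) • v)))
        ≤ ENNReal.ofReal α :=
      ((le_iSup (fun w : {w : Fin n → ℂ // bergmanNorm z w = 1} =>
        ENNReal.ofReal (bergmanNorm z (schwarzianOp f z w))) ⟨_, hunit⟩).trans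
        (le_iSup (fun w : polydisk n => schwarzianNormAt f w) ⟨z, hz⟩)).trans hf
    rw [ENNReal.ofReal_le_ofReal_iff hα, schwarzianOp_smul, bergmanNorm_smul, norm_pow, hc,
      inv_pow, inv_mul_le_iff₀ (by positivity)] at h1
    linarith

/-- The components of the Schwarzian tensor are recovered from the operator by polarization. -/
theorem schwarzianOp_polarization {f : (Fin n → ℂ) → (Fin n → ℂ)}
    (hf : LocallyBiholomorphicOn f (polydisk n)) {z : Fin n → ℂ} (hz : z ∈ polydisk n)
    (k i j : Fin n) :
    schwarzianOp f z (Pi.single i 1 + Pi.single j 1) k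
      - schwarzianOp f z (Pi.single i 1 - Pi.single j 1) k = 4 * schwarzian f k i j z := by
  have h := hf.schwarzian_symm hz k j i
  simp only [schwarzianOp, Pi.add_apply, Pi.sub_apply, add_mul, mul_add, sub_mul, mul_sub,
    Finset.sum_add_distrib, Finset.sum_sub_distrib, Pi.single_apply, ite_mul, mul_ite, mul_zero,
    zero_mul, mul_one, one_mul, Finset.sum_ite_eq', Finset.mem_univ, if_true]
  rw [h]
  ring

theorem sum_norm_sq_single_le {v : Fin n → ℂ} {i j : Fin n}
    (hv : ∀ l, ‖v l‖ ≤ ‖(Pi.single i 1 : Fin n → ℂ) l‖ + ‖(Pi.single j 1 : Fin n → ℂ) l‖) :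
    ∑ l, ‖v l‖ ^ 2 ≤ 4 := by
  have h1 : ∀ l, ‖v l‖ ^ 2 ≤ 2 * (if l = i then 1 else 0) + 2 * (if l = j then (1 : ℝ) else 0) := by
    intro l
    have := pow_le_pow_left₀ (norm_nonneg _) (hv l) 2
    refine this.trans ?_
    simp only [Pi.single_apply]
    split_ifs <;> norm_num
  refine (Finset.sum_le_sum fun l _ => h1 l).trans ?_
  rw [Finset.sum_add_distrib, ← Finset.mul_sum, ← Finset.mul_sum]
  simp
  norm_num

/-- Polarization over `e_i ± e_j`, whose squared Euclidean norms are at most `4`: each value is at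
most `38 · 4 · α = 152 α`, and `2 · 152 / 4 = 76`. -/
theorem norm_schwarzian_le {f : (Fin n → ℂ) → (Fin n → ℂ)}
    (hf : LocallyBiholomorphicOn f (polydisk n)) {α : ℝ} (hα : 0 ≤ α)
    (hS : schwarzianNorm f ≤ ENNReal.ofReal α) {z : Fin n → ℂ} (hz : ∀ i, ‖z i‖ ≤ 7 / 8)
    (k i j : Fin n) : ‖schwarzian f k i j z‖ ≤ 76 * α := by
  have hzp : z ∈ polydisk n := fun i => (hz i).trans_lt (by norm_num)
  have h : ∀ v : Fin n → ℂ, (∑ l, ‖v l‖ ^ 2 ≤ 4) → ‖schwarzianOp f z v k‖ ≤ 152 * α := by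
    intro v hv
    calc ‖schwarzianOp f z v k‖ ≤ bergmanNorm z (schwarzianOp f z v) :=
          norm_apply_le_bergmanNorm hzp _ k
      _ ≤ α * bergmanNorm z v ^ 2 := bergmanNorm_schwarzianOp_le hα hS hzp v
      _ ≤ α * (38 * 4) := by
          refine mul_le_mul_of_nonneg_left ((bergmanNorm_sq_le hz v).trans ?_) hα
          linarith
      _ = 152 * α := by ring
  have h1 := h (Pi.single i 1 + Pi.single j 1) (sum_norm_sq_single_le fun l => norm_add_le _ _)
  have h2 := h (Pi.single i 1 - Pi.single j 1) (sum_norm_sq_single_le fun l => norm_sub_le _ _)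
  have h3 := norm_sub_le (schwarzianOp f z (Pi.single i 1 + Pi.single j 1) k)
    (schwarzianOp f z (Pi.single i 1 - Pi.single j 1) k)
  rw [schwarzianOp_polarization hf hzp, norm_mul] at h3
  norm_num at h3
  linarith

/-- Cauchy's estimate with radius `7/8 - 3/4 = 1/8`, hence `8 · 76 = 608`. -/
theorem norm_pderiv_schwarzian_le {f : (Fin n → ℂ) → (Fin n → ℂ)}
    (hf : LocallyBiholomorphicOn f (polydisk n)) {α : ℝ} (hα : 0 ≤ α)
    (hS : schwarzianNorm f ≤ ENNReal.ofReal α) {z : Fin n → ℂ} (hz : ∀ i, ‖z i‖ ≤ 3 / 4)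
    (m k i j : Fin n) : ‖pderiv m (schwarzian f k i j) z‖ ≤ 608 * α := by
  have hline : ∀ ζ : ℂ, ‖ζ‖ ≤ 1 / 8 → ∀ l, ‖(z + ζ • (Pi.single m 1 : Fin n → ℂ)) l‖ ≤ 7 / 8 := by
    intro ζ hζ l
    have h1 : ‖(ζ • (Pi.single m 1 : Fin n → ℂ)) l‖ ≤ 1 / 8 := by
      simp only [Pi.smul_apply, Pi.single_apply, smul_eq_mul]
      split_ifs
      · simpa using hζ
      · simp
    have h2 := norm_add_le (z l) ((ζ • (Pi.single m 1 : Fin n → ℂ)) l)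
    have h3 := hz l
    rw [Pi.add_apply]
    linarith
  have h := norm_fderiv_apply_le (g := schwarzian f k i j) (z := z) (v := Pi.single m 1)
    (r := 1 / 8) (C := 76 * α) (by norm_num)
    (fun ζ hζ => (hf.differentiableOn_schwarzian k i j).differentiableAt
      (polydisk_mem_nhds fun l => (hline ζ hζ l).trans_lt (by norm_num)))
    fun ζ hζ => norm_schwarzian_le hf hα hS (hline ζ hζ) k i j
  rw [pderiv]
  linarith

/-- The inhomogeneous term of the structure equation is bounded on the polydisk of radius `3/4`. -/
theorem norm_curvature_le {f : (Fin n → ℂ) → (Fin n → ℂ)}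
    (hf : LocallyBiholomorphicOn f (polydisk n)) {α : ℝ} (hα : 0 ≤ α)
    (hS : schwarzianNorm f ≤ ENNReal.ofReal α) {z : Fin n → ℂ} (hz : ∀ i, ‖z i‖ ≤ 3 / 4)
    (i j m : Fin n) :
    ‖pderiv m (schwarzian f m i j) z - pderiv j (schwarzian f m i m) z
        + ∑ k, (schwarzian f m m k z * schwarzian f k i j z
          - schwarzian f m j k z * schwarzian f k i m z)‖ ≤ 20000 * n * (α * (1 + α)) := by
  have hn : (1 : ℝ) ≤ n := by exact_mod_cast (Nat.one_le_iff_ne_zero.2 (Fin.pos i).ne')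
  have hb : ∀ k i j, ‖schwarzian f k i j z‖ ≤ 76 * α := fun k i j =>
    norm_schwarzian_le hf hα hS (fun l => (hz l).trans (by norm_num)) k i j
  have hsum : ‖∑ k, (schwarzian f m m k z * schwarzian f k i j z
      - schwarzian f m j k z * schwarzian f k i m z)‖ ≤ ∑ _k : Fin n, 11552 * α ^ 2 := by
    refine norm_sum_le_of_le _ fun k _ => (norm_sub_le _ _).trans ?_
    rw [norm_mul, norm_mul]
    have h1 := mul_le_mul (hb m m k) (hb k i j) (norm_nonneg _) (by positivity)
    have h2 := mul_le_mul (hb m j k) (hb k i m) (norm_nonneg _) (by positivity)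
    nlinarith
  rw [Finset.sum_const, Finset.card_univ, Fintype.card_fin, nsmul_eq_mul] at hsum
  have h1 := norm_pderiv_schwarzian_le hf hα hS hz m m i j
  have h2 := norm_pderiv_schwarzian_le hf hα hS hz j m i m
  have h3 := norm_sub_le (pderiv m (schwarzian f m i j) z) (pderiv j (schwarzian f m i m) z)
  have h4 := mul_le_mul_of_nonneg_right hn hα
  have h5 : 0 ≤ (n : ℝ) * α ^ 2 := by positivity
  refine (norm_add_le _ _).trans ?_
  nlinarith

end BergmanNorm

/-! ### Riccati systems on the disk with small coefficients. -/

section RiccatiSystem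

open Metric Complex

/-- A function on the closed disk which is uniformly close to `ζ ↦ 1 - A ζ` vanishes in the disk. -/
theorem not_forall_ne_zero_of_near_affine {u : ℂ → ℂ} {ρ A : ℝ} (hρ : 0 < ρ) (hA : 3 / 2 ≤ ρ * A)
    (hu : ∀ ζ : ℂ, ‖ζ‖ ≤ ρ → DifferentiableAt ℂ u ζ)
    (hclose : ∀ ζ : ℂ, ‖ζ‖ ≤ ρ → ‖u ζ - (1 - A * ζ)‖ ≤ ρ * A / 9) :
    ¬ ∀ ζ : ℂ, ‖ζ‖ ≤ ρ → u ζ ≠ 0 := by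
  intro hne
  have hA0 : 0 < A := by
    by_contra h
    nlinarith
  have hmem : ∀ ζ ∈ closure (ball (0 : ℂ) ρ), ‖ζ‖ ≤ ρ := fun ζ hζ => by
    simpa using closure_ball_subset_closedBall hζ
  -- If `u` had no zero, the maximum principle would apply to `h`. On the circle `|1 - Aζ| ≥ ρA - 1
  -- ≥ ρA/3`, so `|u| ≥ 2ρA/9` and `|h| ≤ 1/2`; but `h(1/A) = -1`.
  set h : ℂ → ℂ := fun ζ => ((1 - A * ζ) - u ζ) / u ζ with hh
  have hd : DiffContOnCl ℂ h (ball 0 ρ) := by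
    refine DifferentiableOn.diffContOnCl fun ζ hζ => ?_
    have hdu := hu ζ (hmem ζ hζ)
    exact (DifferentiableAt.div (by fun_prop) hdu (hne ζ (hmem ζ hζ))).differentiableWithinAt
  have hfr : ∀ ζ ∈ frontier (ball (0 : ℂ) ρ), ‖h ζ‖ ≤ 1 / 2 := by
    intro ζ hζ
    rw [frontier_ball _ hρ.ne', mem_sphere_zero_iff_norm] at hζ
    have h1 := hclose ζ hζ.le
    have h2 : ρ * A - 1 ≤ ‖1 - A * ζ‖ := by
      have := norm_sub_norm_le ((A : ℂ) * ζ) 1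
      rw [norm_sub_rev ((A : ℂ) * ζ), norm_mul, Complex.norm_real, Real.norm_of_nonneg hA0.le, hζ,
        norm_one] at this
      linarith
    have h3 : ‖1 - A * ζ‖ - ‖u ζ‖ ≤ ‖u ζ - (1 - A * ζ)‖ := by
      rw [norm_sub_rev (u ζ)]
      exact norm_sub_norm_le _ _
    rw [hh, norm_div, norm_sub_rev _ (u ζ), div_le_iff₀ (norm_pos_iff.2 (hne ζ hζ.le))]
    linarith
  have hpt : ‖((A⁻¹ : ℝ) : ℂ)‖ ≤ ρ := by
    rw [Complex.norm_real, Real.norm_of_nonneg (by positivity), inv_le_iff_one_le_mul₀ hA0]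
    linarith
  have hcl : ((A⁻¹ : ℝ) : ℂ) ∈ closure (ball (0 : ℂ) ρ) := by
    rw [closure_ball _ hρ.ne']
    simpa using hpt
  have hbound := norm_le_of_forall_mem_frontier_norm_le isBounded_ball hd hfr hcl
  have hval : h ((A⁻¹ : ℝ) : ℂ) = -1 := by
    have hAc : (A : ℂ) ≠ 0 := by exact_mod_cast hA0.ne'
    have hu0 := hne _ hpt
    simp only [hh]
    rw [div_eq_iff hu0]
    push_cast
    rw [mul_inv_cancel₀ hAc]
    ring
  rw [hval] at hbound
  norm_num at hbound

/-- Linearization of a Riccati system on the unit disk: there is a nonvanishing `u` such that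
`u` and `p_i = -u a_i` solve a linear system. -/
theorem exists_linearization {n : ℕ} {a : Fin n → ℂ → ℂ} {S : Fin n → Fin n → Fin n → ℂ → ℂ}
    {Q : Fin n → Fin n → ℂ → ℂ} {v : Fin n → ℂ}
    (ha : ∀ i, ∀ ζ ∈ ball (0 : ℂ) 1, HasDerivAt (a i)
      (∑ j, v j * (a i ζ * a j ζ + ∑ k, a k ζ * S k i j ζ + Q i j ζ)) ζ) :
    ∃ (u : ℂ → ℂ) (p : ℂ → Fin n → ℂ), u 0 = 1 ∧ (∀ i, p 0 i = -a i 0) ∧ (∀ ζ, u ζ ≠ 0) ∧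
      (∀ ζ ∈ ball (0 : ℂ) 1, HasDerivAt u (∑ j, v j * p ζ j) ζ) ∧
      ∀ ζ ∈ ball (0 : ℂ) 1, HasDerivAt p
        (fun i => ∑ j, v j * (∑ k, p ζ k * S k i j ζ - u ζ * Q i j ζ)) ζ := by
  have hdiff : DifferentiableOn ℂ (fun ζ => ∑ j, v j * a j ζ) (ball (0 : ℂ) 1) :=
    DifferentiableOn.fun_sum fun j _ => DifferentiableOn.const_mul
      (fun ζ hζ => (ha j ζ hζ).differentiableAt.differentiableWithinAt) _
  obtain ⟨G, hG0, hG⟩ := hdiff.isExactOn_ball.with_val_at 0 0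
  have hu : ∀ ζ ∈ ball (0 : ℂ) 1, HasDerivAt (fun ζ => exp (-G ζ))
      (exp (-G ζ) * -∑ j, v j * a j ζ) ζ := fun ζ hζ => (hG ζ hζ).neg.cexp
  refine ⟨fun ζ => exp (-G ζ), fun ζ i => -(exp (-G ζ) * a i ζ), by simp [hG0], by simp [hG0],
    fun ζ => exp_ne_zero _, fun ζ hζ => ?_, fun ζ hζ => ?_⟩
  · convert! hu ζ hζ using 1
    rw [← Finset.sum_neg_distrib, Finset.mul_sum]
    exact Finset.sum_congr rfl fun j _ => by ring
  · refine hasDerivAt_pi.2 fun i => ?_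
    -- The quadratic terms `u a_i ∑ v_j a_j` coming from `u'` and from `a_i'` cancel.
    convert! ((hu ζ hζ).mul (ha i ζ hζ)).neg using 1
    simp only [mul_neg, neg_mul, neg_add, neg_neg, mul_add, mul_sub, Finset.sum_add_distrib,
      Finset.sum_sub_distrib, Finset.mul_sum, Finset.sum_mul, Finset.sum_neg_distrib]
    have h1 : ∑ j, exp (-G ζ) * (v j * (a i ζ * a j ζ)) = ∑ j, exp (-G ζ) * (v j * a j ζ) * a i ζ :=
      Finset.sum_congr rfl fun j _ => by ring
    have h2 : ∑ j, ∑ k, v j * (exp (-G ζ) * a k ζ * S k i j ζ)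
        = ∑ j, ∑ k, exp (-G ζ) * (v j * (a k ζ * S k i j ζ)) :=
      Finset.sum_congr rfl fun j _ => Finset.sum_congr rfl fun k _ => by ring
    have h3 : ∑ j, v j * (exp (-G ζ) * Q i j ζ) = ∑ j, exp (-G ζ) * (v j * Q i j ζ) :=
      Finset.sum_congr rfl fun j _ => by ring
    linear_combination h1 - h2 - h3

/-- A Riccati system with small coefficients has no solution on the disk with a large initial
value: the nonvanishing solution of the linearized system would be close to an affine function
with a zero in the disk. -/
theorem riccati_initial_value_bound {n : ℕ} (hn : 1 ≤ n) {a : Fin n → ℂ → ℂ}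
    {S : Fin n → Fin n → Fin n → ℂ → ℂ} {Q : Fin n → Fin n → ℂ → ℂ} {v : Fin n → ℂ}
    {ρ s q A : ℝ} (hρ0 : 0 < ρ) (hρ1 : ρ < 1) (hs0 : 0 ≤ s) (hq0 : 0 ≤ q)
    (ha : ∀ i, ∀ ζ ∈ ball (0 : ℂ) 1, HasDerivAt (a i)
      (∑ j, v j * (a i ζ * a j ζ + ∑ k, a k ζ * S k i j ζ + Q i j ζ)) ζ)
    (hv : ∀ j, ‖v j‖ ≤ 1) (hS : ∀ k i j ζ, ‖ζ‖ ≤ ρ → ‖S k i j ζ‖ ≤ s)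
    (hQ : ∀ i j ζ, ‖ζ‖ ≤ ρ → ‖Q i j ζ‖ ≤ q) (hA : ∑ j, v j * a j 0 = A)
    (hA' : ∀ i, ‖a i 0‖ ≤ A)
    (hc₁ : 30 * n * (ρ * n ^ 2 * s + ρ ^ 2 * n ^ 2 * q) ≤ 1)
    (hc₂ : 90 * n * (ρ * n * q) ≤ A) : ρ * A < 3 / 2 := by
  by_contra! hlarge
  obtain ⟨u, p, hu0, hp0, hune, hu, hp⟩ := exists_linearization ha
  have hnR : (1 : ℝ) ≤ n := by exact_mod_cast hn
  have hball : ∀ ζ ∈ closedBall (0 : ℂ) ρ, ζ ∈ ball (0 : ℂ) 1 := fun ζ hζ =>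
    closedBall_subset_ball hρ1 hζ
  have h0mem : (0 : ℂ) ∈ closedBall (0 : ℂ) ρ := mem_closedBall_self hρ0.le
  have hnorm : ∀ ζ ∈ closedBall (0 : ℂ) ρ, ‖ζ‖ ≤ ρ := fun ζ hζ => by simpa using hζ
  have hA0 : 0 ≤ A := (norm_nonneg _).trans (hA' ⟨0, hn⟩)
  -- Compactness makes the maximum `N` of `‖p‖` finite in advance, so that it can be absorbed in
  -- place of a Gronwall argument.
  obtain ⟨ζ₀, hζ₀, hmax⟩ := (isCompact_closedBall (0 : ℂ) ρ).exists_isMaxOn ⟨0, h0mem⟩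
    (f := fun ζ => ‖p ζ‖)
    (fun ζ hζ => (hp ζ (hball ζ hζ)).continuousAt.norm.continuousWithinAt)
  set N : ℝ := ‖p ζ₀‖ with hN
  have hN0 : 0 ≤ N := norm_nonneg _
  have hpN : ∀ ζ ∈ closedBall (0 : ℂ) ρ, ‖p ζ‖ ≤ N := fun ζ hζ => hmax hζ
  have hsum : ∀ (x : Fin n → ℂ) (C : ℝ), ‖x‖ ≤ C → ‖∑ j, v j * x j‖ ≤ n * C := by
    intro x C hx
    have : ‖∑ j, v j * x j‖ ≤ ∑ _j : Fin n, C := by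
      refine norm_sum_le_of_le _ fun j _ => ?_
      rw [norm_mul]
      calc ‖v j‖ * ‖x j‖ ≤ 1 * ‖x j‖ := by gcongr; exact hv j
        _ ≤ C := by rw [one_mul]; exact (norm_le_pi_norm x j).trans hx
    simpa using this
  have hmv : ∀ {F : Type} [NormedAddCommGroup F] [NormedSpace ℂ F] (g g' : ℂ → F) (C : ℝ),
      (∀ ζ ∈ closedBall (0 : ℂ) ρ, HasDerivAt g (g' ζ) ζ) →
      (∀ ζ ∈ closedBall (0 : ℂ) ρ, ‖g' ζ‖ ≤ C) →
      ∀ ζ ∈ closedBall (0 : ℂ) ρ, ‖g ζ - g 0‖ ≤ C * ρ := by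
    intro F _ _ g g' C hg hC ζ hζ
    have h := (convex_closedBall (0 : ℂ) ρ).norm_image_sub_le_of_norm_hasDerivWithin_le
      (fun x hx => (hg x hx).hasDerivWithinAt) hC h0mem hζ
    have hC0 : 0 ≤ C := (norm_nonneg _).trans (hC 0 h0mem)
    refine h.trans (mul_le_mul_of_nonneg_left ?_ hC0)
    simpa using hζ
  have huN : ∀ ζ ∈ closedBall (0 : ℂ) ρ, ‖u ζ‖ ≤ 1 + n * N * ρ := by
    intro ζ hζ
    have h1 := hmv u (fun ζ => ∑ j, v j * p ζ j) (n * N) (fun ζ hζ => hu ζ (hball ζ hζ))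
      (fun ζ hζ => hsum _ _ (hpN ζ hζ)) ζ hζ
    have h2 := norm_sub_norm_le (u ζ) (u 0)
    rw [hu0, norm_one] at h2
    rw [hu0] at h1
    linarith
  set D : ℝ := n * (n * (N * s) + (1 + n * N * ρ) * q) with hD
  have hD0 : 0 ≤ D := by positivity
  have hpD : ∀ ζ ∈ closedBall (0 : ℂ) ρ, ‖p ζ - p 0‖ ≤ D * ρ := by
    refine hmv p _ D (fun ζ hζ => hp ζ (hball ζ hζ)) fun ζ hζ => ?_
    refine (pi_norm_le_iff_of_nonneg hD0).2 fun i => ?_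
    refine hsum (fun j => ∑ k, p ζ k * S k i j ζ - u ζ * Q i j ζ) _ ?_
    refine (pi_norm_le_iff_of_nonneg (by positivity)).2 fun j => ?_
    refine (norm_sub_le _ _).trans (add_le_add ?_ ?_)
    · have : ‖∑ k, p ζ k * S k i j ζ‖ ≤ ∑ _k : Fin n, N * s := by
        refine norm_sum_le_of_le _ fun k _ => ?_
        rw [norm_mul]
        exact mul_le_mul ((norm_le_pi_norm _ k).trans (hpN ζ hζ)) (hS k i j ζ (hnorm ζ hζ))
          (norm_nonneg _) hN0
      simpa using this
    · rw [norm_mul]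
      exact mul_le_mul (huN ζ hζ) (hQ i j ζ (hnorm ζ hζ)) (norm_nonneg _) (by positivity)
  have hp0A : ‖p 0‖ ≤ A := (pi_norm_le_iff_of_nonneg hA0).2 fun i => by
    rw [hp0, norm_neg]
    exact hA' i
  set c₁ : ℝ := ρ * n ^ 2 * s + ρ ^ 2 * n ^ 2 * q with hc₁def
  set c₂ : ℝ := ρ * n * q with hc₂def
  have hc₁0 : 0 ≤ c₁ := by positivity
  have hc₂0 : 0 ≤ c₂ := by positivity
  have hDρ : D * ρ = c₁ * N + c₂ := by
    rw [hD, hc₁def, hc₂def]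
    ring
  have hNle : N ≤ A + (c₁ * N + c₂) := by
    have h1 := hpD ζ₀ hζ₀
    have h2 := norm_sub_norm_le (p ζ₀) (p 0)
    rw [← hDρ]
    linarith
  -- Since `c₁ ≤ 1/30` and `c₂ ≤ A/90`, the term `c₁ N` is absorbed on the left.
  have hN3 : N ≤ 3 * A := by
    have h1 : 30 * c₁ ≤ 1 := by nlinarith
    have h2 : 90 * c₂ ≤ A := by nlinarith
    nlinarith
  -- `n c₁ · 3A + n c₂ ≤ A/10 + A/90 = A/9`.
  have hnD : n * (D * ρ) ≤ A / 9 := by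
    rw [hDρ]
    have h1 : n * c₁ * N ≤ n * c₁ * (3 * A) := by gcongr
    nlinarith
  refine not_forall_ne_zero_of_near_affine hρ0 hlarge
    (fun ζ hζ => (hu ζ (hball ζ (by simpa using hζ))).differentiableAt) (fun ζ hζ => ?_)
    fun ζ _ => hune ζ
  have hpA : ∑ j, v j * p 0 j = -A := by
    simp only [hp0, mul_neg, Finset.sum_neg_distrib, hA]
  -- As `u'(0) = -A`, the derivative of `u - (1 - Aζ)` only sees the variation of `p`, already
  -- bounded by `D ρ`.
  have h := hmv (fun ζ => u ζ - (1 - A * ζ)) (fun ζ => ∑ j, v j * (p ζ j - p 0 j)) (n * (D * ρ))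
    (fun ζ hζ => by
      convert! (hu ζ (hball ζ hζ)).sub (((hasDerivAt_id ζ).const_mul (A : ℂ)).const_sub 1) using 1
      simp only [mul_sub, Finset.sum_sub_distrib, hpA]
      ring)
    (fun ζ hζ => hsum (p ζ - p 0) _ (hpD ζ hζ)) ζ (by simpa using hζ)
  simp only [hu0, mul_zero, sub_zero, sub_self] at h
  calc _ ≤ n * (D * ρ) * ρ := h
    _ ≤ A / 9 * ρ := by gcongr
    _ = ρ * A / 9 := by ring

end RiccatiSystem

/-! ### Choice of the disk and the bound on `∇ log J_f (0)`. -/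

section OrderBound

open Metric

variable {n : ℕ} {f : (Fin n → ℂ) → (Fin n → ℂ)}

/-- The structure equation restricted to a disk through the origin. -/
theorem LocallyBiholomorphicOn.hasDerivAt_logJacobianGrad_slice
    (hf : LocallyBiholomorphicOn f (polydisk n)) {v : Fin n → ℂ} (hv : ∀ j, ‖v j‖ ≤ 1)
    {c : Fin n → Fin n} (hc : ∀ j, c j ≠ j) (i : Fin n) {ζ : ℂ} (hζ : ζ ∈ ball (0 : ℂ) 1) :
    HasDerivAt (fun ξ : ℂ => logJacobianGrad f i (ξ • v))
      (∑ j, v j * (logJacobianGrad f i (ζ • v) * logJacobianGrad f j (ζ • v)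
        + ∑ k, logJacobianGrad f k (ζ • v) * schwarzian f k i j (ζ • v)
        + (pderiv (c j) (schwarzian f (c j) i j) (ζ • v)
          - pderiv j (schwarzian f (c j) i (c j)) (ζ • v)
          + ∑ k, (schwarzian f (c j) (c j) k (ζ • v) * schwarzian f k i j (ζ • v)
            - schwarzian f (c j) j k (ζ • v) * schwarzian f k i (c j) (ζ • v))))) ζ := by
  have hz : ζ • v ∈ polydisk n := fun j => by
    rw [mem_ball_zero_iff] at hζ
    rw [Pi.smul_apply, smul_eq_mul, norm_mul]
    calc ‖ζ‖ * ‖v j‖ ≤ ‖ζ‖ * 1 := by gcongr; exact hv j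
      _ < 1 := by rwa [mul_one]
  have hd := (hf.differentiableOn_logJacobianGrad i).differentiableAt (polydisk_mem_nhds hz)
  have h := hasDerivAt_slice (g := logJacobianGrad f i) (z := 0) (v := v) (ζ := ζ)
    (by rwa [zero_add])
  simp only [zero_add] at h
  rw [fderiv_apply_eq_sum] at h
  simpa only [hf.pderiv_logJacobianGrad hz (hc _)] using h

/-- The Riccati bound applied to `f`: `ρα` small makes the coefficients small, and `hlarge` absorbs
the factor `1 + α` in the bound for `Q`. -/
theorem sum_norm_logJacobianGrad_mul_lt (hn : 2 ≤ n)
    (hf : LocallyBiholomorphicOn f (polydisk n)) {α ρ : ℝ} (hα : 0 ≤ α)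
    (hS : schwarzianNorm f ≤ ENNReal.ofReal α) (hρ0 : 0 < ρ) (hρ : ρ ≤ 3 / 4)
    (hρα : 10 ^ 7 * n ^ 4 * (ρ * α) ≤ 1) (hlarge : 1 + α ≤ ∑ i, ‖logJacobianGrad f i 0‖) :
    ρ * ∑ i, ‖logJacobianGrad f i 0‖ < 3 / 2 := by
  have hnR : (1 : ℝ) ≤ n := by exact_mod_cast (by lia : 1 ≤ n)
  have : Nontrivial (Fin n) := Fin.nontrivial_iff_two_le.2 hn
  choose c hc using fun j : Fin n => exists_ne j
  -- In this direction `∑ v_j a_j(0)` is the `ℓ¹` norm of `a(0)`, and the slice stays in the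
  -- polydisk because `|v_j| = 1`.
  choose v hv hva using fun i => RCLike.exists_norm_eq_mul_self (logJacobianGrad f i 0)
  have hv1 : ∀ j, ‖v j‖ ≤ 1 := fun j => (hv j).le
  have hmem : ∀ ζ : ℂ, ‖ζ‖ ≤ ρ → ∀ l, ‖(ζ • v) l‖ ≤ 3 / 4 := by
    intro ζ hζ l
    rw [Pi.smul_apply, smul_eq_mul, norm_mul, hv, mul_one]
    exact hζ.trans hρ
  have hx0 : 0 ≤ ρ * α := by positivity
  have hpow : ∀ k : ℕ, k ≤ 4 → (n : ℝ) ^ k * (ρ * α) ≤ 1 / 10 ^ 7 := by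
    intro k hk
    have h1 : (n : ℝ) ^ k * (ρ * α) ≤ n ^ 4 * (ρ * α) :=
      mul_le_mul_of_nonneg_right (pow_le_pow_right₀ hnR hk) hx0
    rw [le_div_iff₀ (by positivity)]
    linarith
  refine riccati_initial_value_bound (by lia) (a := fun i ζ => logJacobianGrad f i (ζ • v))
    (S := fun k i j ζ => schwarzian f k i j (ζ • v)) (v := v) (s := 76 * α)
    (q := 20000 * n * (α * (1 + α))) hρ0 (by linarith) (by positivity) (by positivity)
    (fun i ζ hζ => hf.hasDerivAt_logJacobianGrad_slice hv1 hc i hζ) hv1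
    (fun k i j ζ hζ => norm_schwarzian_le hf hα hS
      (fun l => (hmem ζ hζ l).trans (by norm_num)) k i j)
    (fun i j ζ hζ => norm_curvature_le hf hα hS (hmem ζ hζ) i j (c j)) ?_ ?_ ?_ ?_
  · simp only [zero_smul]
    rw [Complex.ofReal_sum]
    exact Finset.sum_congr rfl fun j _ => (hva j).symm
  · intro i
    simp only [zero_smul]
    exact Finset.single_le_sum (f := fun i => ‖logJacobianGrad f i 0‖)
      (fun i _ => norm_nonneg _) (Finset.mem_univ i)
  · have h3 := hpow 3 (by norm_num)
    have h4 := hpow 4 le_rfl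
    have hρ2 : ρ * (1 + α) ≤ 2 := by
      have := hpow 0 (by norm_num)
      rw [pow_zero, one_mul] at this
      linarith
    have h5 : (n : ℝ) ^ 4 * (ρ * α) * (ρ * (1 + α)) ≤ 1 / 10 ^ 7 * 2 := by gcongr
    calc 30 * n * (ρ * n ^ 2 * (76 * α) + ρ ^ 2 * n ^ 2 * (20000 * n * (α * (1 + α))))
        = 2280 * (n ^ 3 * (ρ * α)) + 600000 * (n ^ 4 * (ρ * α) * (ρ * (1 + α))) := by ring
      _ ≤ 1 := by linarith
  · have h3 := hpow 3 (by norm_num)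
    have h5 : (n : ℝ) ^ 3 * (ρ * α) * (1 + α) ≤ 1 / 10 ^ 7 * (1 + α) := by gcongr
    calc 90 * n * (ρ * n * (20000 * n * (α * (1 + α))))
        = 1800000 * (n ^ 3 * (ρ * α) * (1 + α)) := by ring
      _ ≤ 1 + α := by linarith
      _ ≤ _ := hlarge

/-- The radius is `3/4` if `Cα ≤ 1`, giving `(3/2)/(3/4) = 2`, and `1/(2Cα)` otherwise, giving
`3Cα`. The exponent `1 + σ` enters only when `Cα > 1`, where raising to it increases `Cα`. -/
theorem sum_norm_logJacobianGrad_le (hn : 2 ≤ n) (hf : LocallyBiholomorphicOn f (polydisk n))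
    {α σ : ℝ} (hα : 0 ≤ α) (hσ : 0 < σ) (hS : schwarzianNorm f ≤ ENNReal.ofReal α) :
    ∑ i, ‖logJacobianGrad f i 0‖ ≤ 2 + 3 * (10 ^ 7 * (n : ℝ) ^ 4) ^ (1 + σ) * α ^ (1 + σ) := by
  have hnR : (1 : ℝ) ≤ n := by exact_mod_cast (by lia : 1 ≤ n)
  set C : ℝ := 10 ^ 7 * (n : ℝ) ^ 4 with hC
  have hC1 : 1 ≤ C := by
    have := one_le_pow₀ hnR (n := 4)
    rw [hC]
    linarith
  set A : ℝ := ∑ i, ‖logJacobianGrad f i 0‖ with hA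
  rcases le_or_gt (C * α) 1 with hsmall | hbig
  · have h1 : 0 ≤ 3 * C ^ (1 + σ) * α ^ (1 + σ) := by positivity
    have hα1 : α ≤ 1 := by nlinarith
    suffices A ≤ 2 by linarith
    rcases le_or_gt (1 + α) A with h | h
    · have := sum_norm_logJacobianGrad_mul_lt hn hf hα hS (ρ := 3 / 4) (by norm_num) le_rfl
        (by rw [← hC]; nlinarith) h
      linarith
    · linarith
  · have hα0 : 0 < α := by
      by_contra h
      nlinarith
    have h1 : C * α ≤ C ^ (1 + σ) * α ^ (1 + σ) := by
      rw [← Real.mul_rpow (by positivity) hα]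
      exact Real.self_le_rpow_of_one_le hbig.le (by linarith)
    suffices A ≤ 2 + 3 * (C * α) by linarith
    rcases le_or_gt (1 + α) A with h | h
    · have h2 := sum_norm_logJacobianGrad_mul_lt hn hf hα hS (ρ := 1 / (2 * (C * α)))
        (by positivity) (by rw [div_le_iff₀ (by positivity)]; linarith)
        (by
          rw [← hC]
          have : C * (1 / (2 * (C * α)) * α) = 1 / 2 := by field_simp
          rw [this]
          norm_num) h
      rw [← hA, one_div_mul_eq_div, div_lt_iff₀ (by positivity)] at h2
      linarith
    · nlinarith

/-- Since `J_f(0) = 1`, the gradient is `(n + 1) a(0)`, and the Euclidean norm is at most the `ℓ¹`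
norm. -/
theorem gradNorm_jacobian_le (hf1 : jacobianMatrix f 0 = 1) :
    gradNorm (jacobian f) 0 ≤ ((n : ℝ) + 1) * ∑ i, ‖logJacobianGrad f i 0‖ := by
  have hJ : jacobian f 0 = 1 := by rw [jacobian, hf1, Matrix.det_one]
  have hterm : ∀ i, ‖pderiv i (jacobian f) 0‖ = ((n : ℝ) + 1) * ‖logJacobianGrad f i 0‖ := by
    intro i
    have hn1 : (n : ℂ) + 1 ≠ 0 := Nat.cast_add_one_ne_zero n
    have h : pderiv i (jacobian f) 0 = ((n : ℂ) + 1) * logJacobianGrad f i 0 := by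
      rw [logJacobianGrad, hJ]
      field_simp
    have hnorm : ‖(n : ℂ) + 1‖ = (n : ℝ) + 1 := by exact_mod_cast Complex.norm_natCast (n + 1)
    rw [h, norm_mul, hnorm]
  rw [gradNorm, Finset.mul_sum]
  simp only [← hterm]
  refine Real.sqrt_le_iff.2 ⟨Finset.sum_nonneg fun i _ => norm_nonneg _, ?_⟩
  exact Finset.sum_sq_le_sq_sum_of_nonneg fun i _ => norm_nonneg _

end OrderBound

end PolydiskSchwarzian

theorem theorem4p2 (n : ℕ) (hn : 2 ≤ n) (σ : ℝ) (hσ : 0 < σ) :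
    ∃ m : ℝ, 0 < m ∧ ∀ α : ℝ, 0 ≤ α →
      PolydiskSchwarzian.order n α ≤
        ENNReal.ofReal (2 * ((n : ℝ) + 1) + m * α ^ (1 + σ)) := by
  have hn0 : (0 : ℝ) < n := by exact_mod_cast (by lia : 0 < n)
  refine ⟨((n : ℝ) + 1) * (3 * (10 ^ 7 * (n : ℝ) ^ 4) ^ (1 + σ)), by positivity, fun α hα => ?_⟩
  -- A bound by `ENNReal.ofReal` of a real number also contains the finiteness of the order.
  refine iSup_le fun f => ENNReal.ofReal_le_ofReal ?_
  obtain ⟨hf, -, hf1, hS⟩ := f.2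
  calc _ ≤ ((n : ℝ) + 1) * ∑ i, ‖PolydiskSchwarzian.logJacobianGrad f.1 i 0‖ :=
        PolydiskSchwarzian.gradNorm_jacobian_le hf1
    _ ≤ ((n : ℝ) + 1) * (2 + 3 * (10 ^ 7 * (n : ℝ) ^ 4) ^ (1 + σ) * α ^ (1 + σ)) := by
        gcongr
        exact PolydiskSchwarzian.sum_norm_logJacobianGrad_le hn hf hα hσ hS
    _ = _ := by ring
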